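/- Let $\gamma\in(1,2)$, let $(\xi_i)_{i\ge 1}$ be i.i.d. real random variables on a probability space with law $\mathbf{P}$, let $\xi$ be a generic element of the sequence, and let $S_n=\sum_{i=1}^n\xi_i$. Suppose that for every $\varepsilon\in(0,1)$ there exists a constant $C\in(0,\infty)$ such that \[C^{-1}t^{-(1+\varepsilon)\gamma}\le \mathbf{P}(|\xi|\ge t)\le C\,t^{-(1-\varepsilon)\gamma}\qquad\text{for all } t\ge 1.\] Then $\xi$ is integrable and, $\mathbf{P}$-almost surely, \[\limsup_{n\to\infty}\frac{\log|S_n-n\mathbf{E}\xi|}{\log n}=\frac1\gamma \qquad\text{and}\qquad \liminf_{n\to\infty}\frac{\log_+|S_n-n\mathbf{E}\xi|}{\log n}=0,\] where $\log_+(x)=\max\{0,\log x\}$, $\log 0=-\infty$ and $\log_+ 0=0$. -/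

import Mathlib

open MeasureTheory ProbabilityTheory Filter

/-!
Write `γ` for the tail index, and subtract the mean from the steps, so that `S n` is a centred walk.

The upper bound `S n = O(n ^ r)` for `r > 1 / γ` is the Marcinkiewicz–Zygmund law of large numbers.
The steps have moments of every order `q < γ`. Choosing `q ∈ (1, γ)` with `r * q > 1`, a truncation
and the `L²` martingale convergence theorem show that `∑ ξ i / (i + 1) ^ r` converges almost surely
(`ae_exists_tendsto_sum_div_rpow`), and summation by parts turns this into a bound on `S n`.

For `r < 1 / γ`, the second Borel–Cantelli lemma gives infinitely many steps of absolute value at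
least `(n + 1) ^ r` (`ae_frequently_rpow_le_abs`), and the walk is large just before or just after
each of them. These two facts give the upper limit.

The lower limit vanishes because the walk is recurrent: `|S n| < 1` infinitely often
(`ae_frequently_abs_sum_lt_one`). Call `k` an escape time if after time `k` the walk never comes
within distance `ε` of `S k`. The positions at escape times are `ε`-separated, and by the strong law
of large numbers they lie in an interval of length `o(n)` for `k < n`; hence there are only `o(n)`
escape times before `n`. By stationarity of the steps each time has the same probability of being an
escape time, which must therefore be zero. Returning closer and closer to successive positions, the
walk comes back near the origin infinitely often.
-/

open scoped Topology

/-! ### Random series, moments and summation by parts -/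

/-- Summation by parts, as in Kronecker's lemma: convergence of `∑ x i / (i + 1) ^ b` bounds the
partial sums of `x` by a multiple of `n ^ b`. -/
theorem exists_abs_sum_le_mul_rpow_of_tendsto {b c : ℝ} (hb : 0 < b) {x : ℕ → ℝ}
    (h : Tendsto (fun n : ℕ => ∑ i ∈ Finset.range n, x i / ((i : ℝ) + 1) ^ b) atTop (𝓝 c)) :
    ∃ M : ℝ, 0 < M ∧ ∀ n : ℕ, |∑ i ∈ Finset.range n, x i| ≤ M * (n : ℝ) ^ b := by
  obtain ⟨M, hM⟩ := h.abs.bddAbove_range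
  set T : ℕ → ℝ := fun n => ∑ i ∈ Finset.range n, x i / ((i : ℝ) + 1) ^ b with hT
  have hTM : ∀ n, |T n| ≤ M := fun n => hM ⟨n, rfl⟩
  have abel : ∀ n : ℕ, ∑ i ∈ Finset.range n, x i = (n : ℝ) ^ b * T n -
      ∑ i ∈ Finset.range n, (((i : ℝ) + 1) ^ b - (i : ℝ) ^ b) * T i := by
    intro n
    induction n with
    | zero => simp [hT]
    | succ n ih =>
      have hT' : T (n + 1) = T n + x n / ((n : ℝ) + 1) ^ b := Finset.sum_range_succ _ _
      have hpos : 0 < ((n : ℝ) + 1) ^ b := by positivity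
      rw [Finset.sum_range_succ, ih, Finset.sum_range_succ, hT']
      push_cast
      field_simp
      ring
  have hM0 : 0 ≤ M := (abs_nonneg _).trans (hTM 0)
  refine ⟨2 * M + 1, by positivity, fun n => ?_⟩
  have h1 : |∑ i ∈ Finset.range n, (((i : ℝ) + 1) ^ b - (i : ℝ) ^ b) * T i| ≤ (n : ℝ) ^ b * M := by
    refine (Finset.abs_sum_le_sum_abs _ _).trans ?_
    calc ∑ i ∈ Finset.range n, |(((i : ℝ) + 1) ^ b - (i : ℝ) ^ b) * T i|
        ≤ ∑ i ∈ Finset.range n, ((((i + 1 : ℕ) : ℝ)) ^ b - (i : ℝ) ^ b) * M := by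
          refine Finset.sum_le_sum fun i _ => ?_
          have : (i : ℝ) ^ b ≤ ((i : ℝ) + 1) ^ b := by gcongr; linarith
          rw [abs_mul, abs_of_nonneg (sub_nonneg.2 this)]
          push_cast
          exact mul_le_mul_of_nonneg_left (hTM i) (sub_nonneg.2 this)
      _ = (n : ℝ) ^ b * M := by
          rw [← Finset.sum_mul, Finset.sum_range_sub (fun i : ℕ => (i : ℝ) ^ b)]
          simp [Real.zero_rpow hb.ne']
  have hn : 0 ≤ (n : ℝ) ^ b := by positivity
  rw [abel n]
  refine (abs_sub _ _).trans ?_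
  rw [abs_mul, abs_of_nonneg hn]
  nlinarith [mul_le_mul_of_nonneg_left (hTM n) hn]

/-- Kolmogorov's one-series theorem: the partial sums form a martingale bounded in `L²`,
hence in `L¹`. -/
theorem ae_exists_tendsto_sum_of_summable_variance {Ω : Type*} [MeasurableSpace Ω]
    {P : Measure Ω} [IsProbabilityMeasure P] {X : ℕ → Ω → ℝ} (hX : ∀ i, Measurable (X i))
    (hindep : iIndepFun X P) (hL2 : ∀ i, MemLp (X i) 2 P) (hmean : ∀ i, ∫ ω, X i ω ∂P = 0)
    (hvar : Summable fun i => variance (X i) P) :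
    ∀ᵐ ω ∂P, ∃ c, Tendsto (fun n : ℕ => ∑ i ∈ Finset.range n, X i ω) atTop (𝓝 c) := by
  have hsm : ∀ i, StronglyMeasurable (X i) := fun i => (hX i).stronglyMeasurable
  set T : ℕ → Ω → ℝ := fun n => ∑ i ∈ Finset.range (n + 1), X i with hT
  have hTL2 : ∀ n, MemLp (T n) 2 P := fun n => memLp_finsetSum' _ fun i _ => hL2 i
  have hTint : ∀ n, Integrable (T n) P := fun n => (hTL2 n).integrable one_le_two
  -- the partial sums are indexed up to `n` included: the natural filtration at time `n` knows `X n`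
  have hmart : Martingale T (Filtration.natural X hsm) P := by
    refine martingale_of_condExp_sub_eq_zero_nat (fun n => ?_) hTint fun n => ?_
    · refine Finset.stronglyMeasurable_sum _ fun i hi => ?_
      exact (Filtration.stronglyAdapted_natural hsm i).mono
        ((Filtration.natural X hsm).mono (Nat.lt_succ_iff.1 (Finset.mem_range.1 hi)))
    · have : T (n + 1) - T n = X (n + 1) := by
        simp only [hT]; rw [Finset.sum_range_succ _ (n + 1)]; simp
      rw [this]
      refine (hindep.condExp_natural_ae_eq_of_lt hsm (Nat.lt_succ_self n)).trans ?_
      exact Eventually.of_forall fun _ => hmean (n + 1)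
  have hTmean : ∀ n, ∫ ω, T n ω ∂P = 0 := fun n => by
    simp only [hT, Finset.sum_apply]
    rw [integral_finsetSum _ fun i _ => (hL2 i).integrable one_le_two]
    simp [hmean]
  have hTvar : ∀ n, variance (T n) P ≤ ∑' i, variance (X i) P := fun n => by
    rw [hT, IndepFun.variance_sum (fun i _ => hL2 i) fun i _ j _ hij => hindep.indepFun hij]
    exact hvar.sum_le_tsum _ fun i _ => variance_nonneg _ _
  have hbdd : ∀ n, eLpNorm (T n) 1 P ≤ (Real.toNNReal (1 + ∑' i, variance (X i) P)) := fun n => by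
    rw [eLpNorm_one_eq_lintegral_enorm, ← ofReal_integral_norm_eq_lintegral_enorm (hTint n)]
    refine ENNReal.ofReal_le_ofReal ?_
    have hsq : Integrable (fun ω => T n ω ^ 2) P := (hTL2 n).integrable_sq
    calc ∫ ω, ‖T n ω‖ ∂P ≤ ∫ ω, (1 + T n ω ^ 2) ∂P := by
          refine integral_mono (hTint n).norm ((integrable_const _).add hsq) fun ω => ?_
          simp only [Real.norm_eq_abs]
          nlinarith [sq_abs (T n ω), sq_nonneg (|T n ω| - 1), abs_nonneg (T n ω)]
      _ = 1 + variance (T n) P := by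
          rw [integral_add (integrable_const _) hsq, variance_of_integral_eq_zero
            (hTL2 n).aemeasurable (hTmean n)]
          simp
      _ ≤ _ := by gcongr; exact hTvar n
  filter_upwards [hmart.submartingale.exists_ae_tendsto_of_bdd hbdd] with ω ⟨c, hc⟩
  refine ⟨c, (tendsto_add_atTop_iff_nat 1).1 ?_⟩
  simpa [hT] using hc

/-- A tail of order `t ^ (-s)` has all moments of order `q < s`, by the layer-cake formula. -/
theorem memLp_of_tail_le {Ω : Type*} [MeasurableSpace Ω]
    {P : Measure Ω} [IsProbabilityMeasure P] {X : Ω → ℝ} (hX : AEMeasurable X P) {q s C : ℝ}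
    (hq : 0 < q) (hqs : q < s)
    (htail : ∀ t : ℝ, 1 ≤ t → P.real {ω | t ≤ |X ω|} ≤ C * t ^ (-s)) :
    MemLp X (ENNReal.ofReal q) P := by
  have hq0 : ENNReal.ofReal q ≠ 0 := by simpa using hq
  rw [← integrable_norm_rpow_iff hX.aestronglyMeasurable hq0 ENNReal.ofReal_ne_top,
    ENNReal.toReal_ofReal hq.le]
  refine ⟨(hX.norm.pow_const q).aestronglyMeasurable, ?_⟩
  rw [hasFiniteIntegral_iff_ofReal (Eventually.of_forall fun ω => by positivity),
    lintegral_rpow_eq_lintegral_meas_le_mul P (Eventually.of_forall fun ω => norm_nonneg _)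
      hX.norm hq]
  refine ENNReal.mul_lt_top ENNReal.ofReal_lt_top ?_
  rw [← Set.Ioc_union_Ioi_eq_Ioi zero_le_one]
  refine (lintegral_union_le _ _ _).trans_lt (ENNReal.add_lt_top.2 ⟨?_, ?_⟩)
  -- near zero the probability is bounded by one, beyond one by the tail hypothesis
  · have hint : IntegrableOn (fun t : ℝ => t ^ (q - 1)) (Set.Ioc 0 1) := by
      have := intervalIntegral.intervalIntegrable_rpow' (a := 0) (b := 1) (r := q - 1)
        (by linarith)
      rwa [intervalIntegrable_iff_integrableOn_Ioc_of_le zero_le_one] at this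
    refine lt_of_le_of_lt (lintegral_mono fun t => ?_) (hasFiniteIntegral_iff_enorm.1 hint.2)
    calc _ ≤ 1 * ENNReal.ofReal (t ^ (q - 1)) := by gcongr; exact prob_le_one
      _ ≤ _ := by rw [one_mul]; exact Real.ofReal_le_enorm _
  · have hint : IntegrableOn (fun t : ℝ => C * t ^ (q - 1 - s)) (Set.Ioi 1) :=
      (integrableOn_Ioi_rpow_of_lt (by linarith) one_pos).const_mul C
    refine lt_of_le_of_lt (setLIntegral_mono' measurableSet_Ioi fun t ht => ?_)
      (hasFiniteIntegral_iff_enorm.1 hint.2)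
    have ht0 : (0 : ℝ) < t := one_pos.trans ht
    rw [← ofReal_measureReal (measure_ne_top _ _), ← ENNReal.ofReal_mul measureReal_nonneg]
    refine (ENNReal.ofReal_le_ofReal ?_).trans (Real.ofReal_le_enorm _)
    calc _ ≤ C * t ^ (-s) * t ^ (q - 1) := by
          gcongr; exact htail t (le_of_lt ht)
      _ = _ := by rw [mul_assoc, ← Real.rpow_add ht0]; congr 2; ring

/-! ### Recurrence of centred random walks -/

open Classical in
/-- The indices `k < n` such that `s` stays at distance at least `ε` from `s k` after time `k`. -/
noncomputable def escapeTimes (s : ℕ → ℝ) (ε : ℝ) (n : ℕ) : Finset ℕ :=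
  {k ∈ Finset.range n | ∀ j, k < j → ε ≤ |s j - s k|}

/-- From time `K` on the path lies in `[-δ n, δ n]`, and its positions at two escape times differ
by at least `ε`, so they have different floors after division by `ε`. -/
theorem card_escapeTimes_le {s : ℕ → ℝ} {ε δ : ℝ} (hε : 0 < ε) (hδ : 0 ≤ δ) {K : ℕ}
    (hs : ∀ k, K ≤ k → |s k| ≤ δ * k) (n : ℕ) :
    ((escapeTimes s ε n).card : ℝ) ≤ K + (2 * (δ * n / ε) + 2) := by
  classical
  set a : ℝ := δ * n / ε with ha
  have ha0 : 0 ≤ a := by positivity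
  have hmaps : Set.MapsTo (fun k => ⌊s k / ε⌋) ((escapeTimes s ε n).filter (K ≤ ·) : Finset ℕ)
      (Finset.Icc ⌊-a⌋ ⌊a⌋) := by
    intro k hk
    simp only [escapeTimes, Finset.coe_filter, Finset.mem_filter, Finset.mem_range,
      Set.mem_ofPred_eq] at hk
    have h1 : |s k / ε| ≤ a := by
      rw [abs_div, abs_of_pos hε, ha]
      gcongr
      refine (hs k hk.2).trans ?_
      gcongr
      exact hk.1.1.le
    simp only [Finset.coe_Icc, Set.mem_Icc]
    exact ⟨Int.floor_mono (abs_le.1 h1).1, Int.floor_mono (abs_le.1 h1).2⟩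
  have hne : ∀ k ∈ escapeTimes s ε n, ∀ l, k < l → ⌊s k / ε⌋ ≠ ⌊s l / ε⌋ := by
    intro k hk l hkl heq
    have h1 := Int.abs_sub_lt_one_of_floor_eq_floor heq
    rw [← sub_div, abs_div, abs_of_pos hε, div_lt_one hε, abs_sub_comm] at h1
    exact absurd ((Finset.mem_filter.1 hk).2 l hkl) (not_le.2 h1)
  have hinj : Set.InjOn (fun k => ⌊s k / ε⌋)
      ((escapeTimes s ε n).filter (K ≤ ·) : Finset ℕ) := by
    intro k hk l hl heq
    rcases lt_trichotomy k l with h | h | h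
    · exact absurd heq (hne k (Finset.mem_filter.1 hk).1 l h)
    · exact h
    · exact absurd heq.symm (hne l (Finset.mem_filter.1 hl).1 k h)
  have hcard := Finset.card_le_card_of_injOn _ hmaps hinj
  have hlow : ((escapeTimes s ε n).filter (¬ K ≤ ·)).card ≤ K := by
    refine (Finset.card_le_card (t := Finset.range K) fun k hk => ?_).trans (by simp)
    simpa using (Finset.mem_filter.1 hk).2
  have hIcc : ((Finset.Icc ⌊-a⌋ ⌊a⌋).card : ℝ) ≤ 2 * a + 2 := by
    rw [Int.card_Icc]
    have : ⌊-a⌋ ≤ ⌊a⌋ := Int.floor_mono (by linarith)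
    have h2 : ((⌊a⌋ + 1 - ⌊-a⌋).toNat : ℝ) = ((⌊a⌋ + 1 - ⌊-a⌋ : ℤ) : ℝ) := by
      exact_mod_cast congrArg (Int.cast (R := ℝ)) (Int.toNat_of_nonneg (by omega))
    rw [h2]
    push_cast
    linarith [Int.floor_le a, Int.lt_floor_add_one (-a)]
  rw [← Finset.card_filter_add_card_filter_not (s := escapeTimes s ε n) (K ≤ ·)]
  push_cast
  have := (Nat.cast_le (α := ℝ)).2 hcard
  have := (Nat.cast_le (α := ℝ)).2 hlow
  linarith

theorem tendsto_card_escapeTimes_div {s : ℕ → ℝ} {ε : ℝ} (hε : 0 < ε)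
    (hs : Tendsto (fun n : ℕ => s n / n) atTop (𝓝 0)) :
    Tendsto (fun n : ℕ => ((escapeTimes s ε n).card : ℝ) / n) atTop (𝓝 0) := by
  rw [tendsto_order]
  refine ⟨fun a ha => Eventually.of_forall fun n => ha.trans_le (by positivity), fun η hη => ?_⟩
  obtain ⟨K, hK⟩ : ∃ K : ℕ, ∀ k, K ≤ k → |s k| ≤ (η * ε / 4) * k := by
    have h := (tendsto_order.1 hs.abs).2 (η * ε / 4) (by simp; positivity)
    obtain ⟨K, hK⟩ := eventually_atTop.1 (h.and (eventually_gt_atTop 0))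
    refine ⟨K, fun k hk => ?_⟩
    obtain ⟨h1, h2⟩ := hK k hk
    have h2' : (0 : ℝ) < k := by exact_mod_cast h2
    rw [abs_div, abs_of_pos h2', div_lt_iff₀ h2'] at h1
    exact h1.le
  have hlim : Tendsto (fun n : ℕ => ((K : ℝ) + 2) / n + η / 2) atTop (𝓝 (0 + η / 2)) :=
    (tendsto_const_div_atTop_nhds_zero_nat _).add_const _
  filter_upwards [(tendsto_order.1 hlim).2 η (by linarith), eventually_gt_atTop 0] with n hn hn0
  have hn0' : (0 : ℝ) < n := by exact_mod_cast hn0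
  refine lt_of_le_of_lt ?_ hn
  have hle := card_escapeTimes_le hε (by positivity : 0 ≤ η * ε / 4) hK n
  rw [div_le_iff₀ hn0', add_mul, div_mul_cancel₀ _ hn0'.ne']
  refine hle.trans (le_of_eq ?_)
  field_simp
  ring

/-- If the path returns arbitrarily close to each of its positions, then chaining returns at
distances `1 / 2, 1 / 4, …` shows that it comes back infinitely often to within distance
one of its start. -/
theorem frequently_abs_lt_one_of_return {s : ℕ → ℝ} (h0 : s 0 = 0)
    (hs : ∀ m k : ℕ, ∃ j, k < j ∧ |s j - s k| < (1 / 2) ^ m) : ∃ᶠ n in atTop, |s n| < 1 := by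
  choose f hf1 hf2 using hs
  let u : ℕ → ℕ := fun i => Nat.rec 0 (fun i k => f (i + 1) k) i
  have hu : ∀ i, u (i + 1) = f (i + 1) (u i) := fun i => rfl
  have hmono : StrictMono u := strictMono_nat_of_lt_succ fun i => by rw [hu]; exact hf1 _ _
  have hbound : ∀ i, |s (u i)| ≤ 1 - (1 / 2) ^ i := by
    intro i
    induction i with
    | zero => simp [u, h0]
    | succ i ih =>
      have h1 := hf2 (i + 1) (u i)
      rw [← hu] at h1
      have h2 := abs_sub_abs_le_abs_sub (s (u (i + 1))) (s (u i))
      rw [pow_succ] at h1 ⊢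
      linarith
  refine frequently_atTop.2 fun N => ⟨u N, hmono.le_apply, (hbound N).trans_lt ?_⟩
  have : (0 : ℝ) < (1 / 2) ^ N := by positivity
  linarith

/-- Recurrence of an integrable centred random walk. The event `A ε k` that the walk stays at
distance at least `ε` from its position at time `k` ever after has a probability independent of
`k`, so that the expected number of `k < n` for which it occurs is `n * P (A ε 0)`. Since that
number is `o(n)` almost surely, `P (A ε 0) = 0`. -/
theorem ae_frequently_abs_sum_lt_one {Ω : Type*} [MeasurableSpace Ω]
    {P : Measure Ω} [IsProbabilityMeasure P] {X : ℕ → Ω → ℝ} (hX : ∀ i, Measurable (X i))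
    (hindep : iIndepFun X P) (hident : ∀ i, IdentDistrib (X i) (X 0) P P)
    (hint : Integrable (X 0) P) (hmean : ∫ ω, X 0 ω ∂P = 0) :
    ∀ᵐ ω ∂P, ∃ᶠ n : ℕ in atTop, |∑ i ∈ Finset.range n, X i ω| < 1 := by
  classical
  set S : Ω → ℕ → ℝ := fun ω n => ∑ i ∈ Finset.range n, X i ω with hS
  have hSm : ∀ n, Measurable fun ω => S ω n := fun n =>
    Finset.measurable_sum _ fun i _ => hX i
  have hslln : ∀ᵐ ω ∂P, Tendsto (fun n : ℕ => S ω n / n) atTop (𝓝 0) := by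
    have := strong_law_ae_real X hint (fun i j hij => hindep.indepFun hij) hident
    rwa [hmean] at this
  let A : ℝ → ℕ → Set Ω := fun ε k => {ω | ∀ j, k < j → ε ≤ |S ω j - S ω k|}
  have hAm : ∀ ε k, MeasurableSet (A ε k) := fun ε k => by
    simp only [A, Set.ofPred_forall]
    exact MeasurableSet.iInter fun j => MeasurableSet.iInter fun _ =>
      measurableSet_le measurable_const ((hSm j).sub (hSm k)).abs
  have hshift : ∀ ε k, P.real (A ε k) = P.real (A ε 0) := by
    intro ε k
    let B : Set (ℕ → ℝ) := {x | ∀ l, 0 < l → ε ≤ |∑ i ∈ Finset.range l, x i|}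
    have hB : MeasurableSet B := by
      simp only [B, Set.ofPred_forall]
      exact MeasurableSet.iInter fun l => MeasurableSet.iInter fun _ =>
        measurableSet_le measurable_const
          (Finset.measurable_sum _ fun i _ => measurable_pi_apply i).abs
    have hAB : ∀ k, A ε k = (fun ω i => X (k + i) ω) ⁻¹' B := by
      intro k
      ext ω
      simp only [A, B, hS, Set.mem_ofPred_eq, Set.mem_preimage]
      constructor
      · intro h l hl
        have := h (k + l) (by omega)
        rwa [Finset.sum_range_add, add_sub_cancel_left] at this
      · intro h j hj
        obtain ⟨l, rfl⟩ := Nat.exists_eq_add_of_lt hj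
        have := h (l + 1) (by omega)
        rwa [add_assoc, Finset.sum_range_add, add_sub_cancel_left]
    have hpi : IdentDistrib (fun ω i => X (k + i) ω) (fun ω i => X i ω) P P :=
      IdentDistrib.pi (fun i => (hident (k + i)).trans (hident i).symm)
        (hindep.precomp (add_right_injective k)) hindep
    rw [hAB k, hAB 0]
    simp only [zero_add]
    rw [measureReal_def, measureReal_def, hpi.measure_mem_eq hB]
  have hcard : ∀ ε n ω, ((escapeTimes (S ω) ε n).card : ℝ) =
      ∑ k ∈ Finset.range n, (A ε k).indicator (fun _ => (1 : ℝ)) ω := by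
    intro ε n ω
    rw [escapeTimes, Finset.card_filter]
    push_cast
    exact Finset.sum_congr rfl fun k _ => by simp [Set.indicator, A]
  have hzero : ∀ ε, 0 < ε → P.real (A ε 0) = 0 := by
    intro ε hε
    have hlim : Tendsto (fun n : ℕ => ∫ ω, ((escapeTimes (S ω) ε n).card : ℝ) / n ∂P) atTop
        (𝓝 (∫ _, (0 : ℝ) ∂P)) := by
      refine tendsto_integral_of_dominated_convergence (fun _ => 1) (fun n => ?_)
        (integrable_const _) (fun n => Eventually.of_forall fun ω => ?_) ?_
      · simp_rw [hcard]
        exact ((Finset.measurable_sum _ fun k _ =>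
          measurable_const.indicator (hAm ε k)).div_const _).aestronglyMeasurable
      · rw [Real.norm_of_nonneg (by positivity)]
        refine div_le_one_of_le₀ ?_ (by positivity)
        exact_mod_cast (Finset.card_filter_le _ _).trans (by simp)
      · filter_upwards [hslln] with ω hω using tendsto_card_escapeTimes_div hε hω
    rw [integral_zero] at hlim
    refine tendsto_nhds_unique (tendsto_const_nhds.congr' ?_) hlim
    filter_upwards [eventually_gt_atTop 0] with n hn
    have hn' : (n : ℝ) ≠ 0 := by exact_mod_cast hn.ne'
    simp_rw [hcard]
    rw [integral_div, integral_finsetSum _ fun k _ =>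
      (integrable_const (1 : ℝ)).indicator (hAm ε k)]
    simp [integral_indicator_const, hAm, hshift ε, hn']
  have hreturn : ∀ᵐ ω ∂P, ∀ m k : ℕ, ω ∉ A ((1 / 2) ^ m) k := by
    refine ae_all_iff.2 fun m => ae_all_iff.2 fun k => measure_eq_zero_iff_ae_notMem.1 ?_
    rw [← measureReal_eq_zero_iff, hshift]
    exact hzero _ (by positivity)
  filter_upwards [hreturn] with ω hω
  refine frequently_abs_lt_one_of_return (s := S ω) (by simp [hS]) fun m k => ?_
  simpa [A] using hω m k

/-! ### Truncation and normalised series -/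

/-- Truncation of a real number at level `a`: the number itself if its absolute value is at most
`a`, and zero otherwise. -/
noncomputable def truncAt (a x : ℝ) : ℝ := {y : ℝ | |y| ≤ a}.indicator id x

theorem measurable_truncAt (a : ℝ) : Measurable (truncAt a) :=
  measurable_id.indicator (measurableSet_le measurable_id.abs measurable_const)

theorem truncAt_of_le {a x : ℝ} (h : |x| ≤ a) : truncAt a x = x :=
  Set.indicator_of_mem (s := {y : ℝ | |y| ≤ a}) h id

theorem truncAt_of_lt {a x : ℝ} (h : a < |x|) : truncAt a x = 0 :=
  Set.indicator_of_notMem (s := {y : ℝ | |y| ≤ a}) (not_le.2 h) id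

theorem abs_truncAt_le {a : ℝ} (ha : 0 ≤ a) (x : ℝ) : |truncAt a x| ≤ a := by
  rcases le_or_gt |x| a with h | h
  · rwa [truncAt_of_le h]
  · rwa [truncAt_of_lt h, abs_zero]

theorem sq_truncAt_le {a q : ℝ} (ha : 0 < a) (hq0 : 0 < q) (hq : q ≤ 2) (x : ℝ) :
    truncAt a x ^ 2 ≤ a ^ (2 - q) * |x| ^ q := by
  rcases le_or_gt |x| a with h | h
  · rw [truncAt_of_le h, ← sq_abs]
    rcases (abs_nonneg x).eq_or_lt with h0 | h0
    · rw [← h0, Real.zero_rpow hq0.ne']; simp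
    · calc |x| ^ 2 = |x| ^ (2 - q) * |x| ^ q := by
            rw [← Real.rpow_add h0, sub_add_cancel, Real.rpow_two]
        _ ≤ _ := by gcongr
  · rw [truncAt_of_lt h, zero_pow two_ne_zero]; positivity

theorem abs_sub_truncAt_le {a q : ℝ} (ha : 0 < a) (hq : 1 ≤ q) (x : ℝ) :
    |x - truncAt a x| ≤ a ^ (1 - q) * |x| ^ q := by
  rcases le_or_gt |x| a with h | h
  · rw [truncAt_of_le h, sub_self, abs_zero]; positivity
  · rw [truncAt_of_lt h, sub_zero]
    have h0 : 0 < |x| := ha.trans h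
    calc |x| = |x| ^ (1 - q) * |x| ^ q := by
          rw [← Real.rpow_add h0, sub_add_cancel, Real.rpow_one]
      _ ≤ _ := mul_le_mul_of_nonneg_right
          (Real.rpow_le_rpow_of_nonpos ha h.le (by linarith)) (by positivity)

theorem measureReal_lt_abs_le {Ω : Type*} [MeasurableSpace Ω] {P : Measure Ω}
    [IsProbabilityMeasure P] {X : Ω → ℝ} {a q : ℝ} (ha : 0 < a) (hq : 0 < q)
    (hint : Integrable (fun ω => |X ω| ^ q) P) :
    P.real {ω | a < |X ω|} ≤ a ^ (-q) * ∫ ω, |X ω| ^ q ∂P := by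
  have haq : 0 < a ^ q := by positivity
  rw [Real.rpow_neg ha.le, inv_mul_eq_div, le_div_iff₀ haq, mul_comm]
  refine le_trans ?_ (mul_meas_ge_le_integral_of_nonneg
    (Eventually.of_forall fun ω => by positivity) hint (a ^ q))
  gcongr ?_ * ?_
  refine measureReal_mono fun ω (hω : a < |X ω|) => ?_
  exact Real.rpow_le_rpow ha.le hω.le hq.le

/-- Convergence of the series `∑ X i / (i + 1) ^ b` for independent centred variables with bounded
moments of order `q ∈ [1, 2]`, where `b * q > 1`. After truncation at level `a i = (i + 1) ^ b`, the
variances and the means of the normalised terms, and the probabilities that the truncation changes a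
term, are all bounded by a constant multiple of the summable `a i ^ (-q)`. -/
theorem ae_exists_tendsto_sum_div_rpow {Ω : Type*} [MeasurableSpace Ω]
    {P : Measure Ω} [IsProbabilityMeasure P] {X : ℕ → Ω → ℝ} (hX : ∀ i, Measurable (X i))
    (hindep : iIndepFun X P) (hXint : ∀ i, Integrable (X i) P) (hmean : ∀ i, ∫ ω, X i ω ∂P = 0)
    {b q K : ℝ} (hq1 : 1 ≤ q) (hq2 : q ≤ 2) (hbq : 1 < b * q)
    (hint : ∀ i, Integrable (fun ω => |X i ω| ^ q) P) (hK : ∀ i, ∫ ω, |X i ω| ^ q ∂P ≤ K) :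
    ∀ᵐ ω ∂P, ∃ c, Tendsto
      (fun n : ℕ => ∑ i ∈ Finset.range n, X i ω / ((i : ℝ) + 1) ^ b) atTop (𝓝 c) := by
  have hq0 : 0 < q := one_pos.trans_le hq1
  set a : ℕ → ℝ := fun i => ((i : ℝ) + 1) ^ b with ha
  have ha0 : ∀ i, 0 < a i := fun i => by positivity
  have hK0 : 0 ≤ K := (integral_nonneg fun ω => by positivity).trans (hK 0)
  have hsum : Summable fun i => a i ^ (-q) * K := by
    refine Summable.mul_right K ?_
    have h := (summable_nat_add_iff 1).2 (Real.summable_nat_rpow.2 (by linarith : -(b * q) < -1))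
    refine h.congr fun i => ?_
    rw [ha, ← Real.rpow_mul (by positivity)]
    push_cast
    ring_nf
  set Y : ℕ → Ω → ℝ := fun i ω => truncAt (a i) (X i ω) with hY
  have hYm : ∀ i, Measurable (Y i) := fun i => (measurable_truncAt _).comp (hX i)
  have hYL2 : ∀ i, MemLp (Y i) 2 P := fun i =>
    MemLp.of_bound (hYm i).aestronglyMeasurable (a i)
      (Eventually.of_forall fun ω => abs_truncAt_le (ha0 i).le _)
  have hYint : ∀ i, Integrable (Y i) P := fun i => (hYL2 i).integrable one_le_two
  have hpow : ∀ i (r : ℝ), a i ^ (r - q) = a i ^ (-q) * a i ^ r := fun i r => by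
    rw [← Real.rpow_add (ha0 i)]; ring_nf
  -- the truncated terms, centred and normalised, have summable variances
  have h1 : ∀ᵐ ω ∂P, ∃ c, Tendsto (fun n : ℕ => ∑ i ∈ Finset.range n,
      (Y i ω - ∫ ω', Y i ω' ∂P) * (a i)⁻¹) atTop (𝓝 c) := by
    refine ae_exists_tendsto_sum_of_summable_variance
      (X := fun i ω => (Y i ω - ∫ ω', Y i ω' ∂P) * (a i)⁻¹)
      (fun i => ((hYm i).sub_const _).mul_const _) ?_ ?_ ?_ ?_
    · exact hindep.comp (fun i x => (truncAt (a i) x - ∫ ω', Y i ω' ∂P) * (a i)⁻¹)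
        fun i => ((measurable_truncAt _).sub_const _).mul_const _
    · exact fun i => ((hYL2 i).sub (memLp_const _)).mul_const _
    · intro i
      rw [integral_mul_const, integral_sub (hYint i) (integrable_const _)]
      simp
    · refine Summable.of_nonneg_of_le (fun i => variance_nonneg _ _) (fun i => ?_) hsum
      rw [variance_mul_const, variance_sub_const (hYm i).aestronglyMeasurable]
      have hle : variance (Y i) P ≤ a i ^ (2 - q) * K := by
        refine (variance_le_expectation_sq (hYm i).aestronglyMeasurable).trans ?_
        calc ∫ ω, (Y i ^ 2) ω ∂P ≤ ∫ ω, a i ^ (2 - q) * |X i ω| ^ q ∂P :=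
              integral_mono (hYL2 i).integrable_sq ((hint i).const_mul _)
                fun ω => sq_truncAt_le (ha0 i) hq0 hq2 _
          _ ≤ _ := by
              rw [integral_const_mul]
              exact mul_le_mul_of_nonneg_left (hK i) (Real.rpow_nonneg (ha0 i).le _)
      rw [hpow, Real.rpow_two] at hle
      have h0 := ha0 i
      calc _ ≤ a i ^ (-q) * a i ^ 2 * K * (a i)⁻¹ ^ 2 := by gcongr
        _ = _ := by field_simp
  -- the means of the truncated terms
  have h2 : Summable fun i => (∫ ω, Y i ω ∂P) * (a i)⁻¹ := by
    refine Summable.of_norm_bounded hsum fun i => ?_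
    have hle : |∫ ω, Y i ω ∂P| ≤ a i ^ (1 - q) * K := by
      have : ∫ ω, Y i ω ∂P = -∫ ω, (X i ω - Y i ω) ∂P := by
        rw [integral_sub (hXint i) (hYint i), hmean]; ring
      rw [this, abs_neg]
      refine abs_integral_le_integral_abs.trans ?_
      calc ∫ ω, |X i ω - Y i ω| ∂P ≤ ∫ ω, a i ^ (1 - q) * |X i ω| ^ q ∂P :=
            integral_mono ((hXint i).sub (hYint i)).abs ((hint i).const_mul _)
              fun ω => abs_sub_truncAt_le (ha0 i) hq1 _
        _ ≤ _ := by
            rw [integral_const_mul]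
            exact mul_le_mul_of_nonneg_left (hK i) (Real.rpow_nonneg (ha0 i).le _)
    have h0 := ha0 i
    rw [hpow, Real.rpow_one] at hle
    rw [Real.norm_eq_abs, abs_mul, abs_of_pos (inv_pos.2 h0)]
    calc _ ≤ a i ^ (-q) * a i * K * (a i)⁻¹ := by gcongr
      _ = _ := by field_simp
  -- only finitely many terms are changed by the truncation
  have h3 : ∀ᵐ ω ∂P, ∀ᶠ i in atTop, ω ∉ {ω | a i < |X i ω|} := by
    refine ae_eventually_notMem ?_
    have hs : Summable fun i => P.real {ω | a i < |X i ω|} := by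
      refine Summable.of_nonneg_of_le (fun i => measureReal_nonneg) (fun i => ?_) hsum
      exact (measureReal_lt_abs_le (ha0 i) hq0 (hint i)).trans
        (mul_le_mul_of_nonneg_left (hK i) (Real.rpow_nonneg (ha0 i).le _))
    have := hs.tsum_ofReal_ne_top
    simpa only [ofReal_measureReal (measure_ne_top _ _)] using this
  filter_upwards [h1, h3] with ω ⟨c, hc⟩ hω
  have h4 : Summable fun i => (X i ω - Y i ω) * (a i)⁻¹ := by
    obtain ⟨N, hN⟩ := eventually_atTop.1 hω
    refine summable_of_ne_finset_zero (s := Finset.range N) fun i hi => ?_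
    have hle : |X i ω| ≤ a i := not_lt.1 (hN i (by simpa using hi))
    simp [hY, truncAt_of_le hle]
  refine ⟨_, ((hc.add h2.hasSum.tendsto_sum_nat).add h4.hasSum.tendsto_sum_nat).congr fun n => ?_⟩
  rw [← Finset.sum_add_distrib, ← Finset.sum_add_distrib]
  refine Finset.sum_congr rfl fun i _ => ?_
  rw [div_eq_mul_inv]
  ring

/-! ### Large steps -/

/-- The second Borel–Cantelli lemma: the events have probabilities at least `c / (n + 1)`. -/
theorem ae_frequently_rpow_le_abs {Ω : Type*} [MeasurableSpace Ω]
    {P : Measure Ω} [IsProbabilityMeasure P] {X : ℕ → Ω → ℝ} (hX : ∀ i, Measurable (X i))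
    (hindep : iIndepFun X P) (hident : ∀ i, IdentDistrib (X i) (X 0) P P)
    {a s c : ℝ} (ha : 0 ≤ a) (has : a * s ≤ 1) (hc : 0 < c)
    (htail : ∀ t : ℝ, 1 ≤ t → c * t ^ (-s) ≤ P.real {ω | t ≤ |X 0 ω|}) :
    ∀ᵐ ω ∂P, ∃ᶠ n : ℕ in atTop, ((n : ℝ) + 1) ^ a ≤ |X n ω| := by
  let E : ℕ → Set ℝ := fun n => {x | ((n : ℝ) + 1) ^ a ≤ |x|}
  have hE : ∀ n, MeasurableSet (E n) := fun n =>
    measurableSet_le measurable_const measurable_id.abs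
  have hm : ∀ n, MeasurableSet (X n ⁻¹' E n) := fun n => hX n (hE n)
  have hset : iIndepSet (fun n => X n ⁻¹' E n) P := by
    rw [iIndepSet_iff_meas_biInter hm]
    exact fun S => hindep.measure_inter_preimage_eq_mul S fun i _ => hE i
  have hdiv : ∑' n, P (X n ⁻¹' E n) = ⊤ := by
    by_contra hfin
    have hsum := ENNReal.summable_toReal hfin
    have hharm : Summable fun n : ℕ => ((n : ℝ) + 1)⁻¹ := by
      refine (Summable.of_nonneg_of_le (fun n => by positivity) (fun n => ?_)
        (hsum.mul_left c⁻¹))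
      have hn1 : (1 : ℝ) ≤ (n : ℝ) + 1 := by linarith [n.cast_nonneg (α := ℝ)]
      have h1 : c * (((n : ℝ) + 1) ^ a) ^ (-s) ≤ P.real (X 0 ⁻¹' E n) :=
        htail _ (Real.one_le_rpow hn1 ha)
      rw [(hident n).measure_mem_eq (hE n), ← div_eq_inv_mul, le_div_iff₀ hc, mul_comm]
      refine le_trans ?_ h1
      rw [← Real.rpow_mul (by positivity), ← Real.rpow_neg_one]
      exact mul_le_mul_of_nonneg_left
        (Real.rpow_le_rpow_of_exponent_le hn1 (by linarith)) hc.le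
    refine Real.not_summable_natCast_inv ((summable_nat_add_iff 1).1 (hharm.congr fun n => ?_))
    push_cast
    rfl
  have hone := measure_limsup_eq_one hm hset hdiv
  have := (prob_compl_eq_zero_iff (MeasurableSet.measurableSet_limsup hm)).2 hone
  filter_upwards [measure_eq_zero_iff_ae_notMem.1 this] with ω hω
  exact mem_limsup_iff_frequently_mem.1 (not_not.1 hω)

theorem eventually_const_mul_rpow_le (M : ℝ) {r s : ℝ} (hrs : r < s) :
    ∀ᶠ n : ℕ in atTop, M * (n : ℝ) ^ r ≤ (n : ℝ) ^ s := by
  have h := (tendsto_rpow_atTop (sub_pos.2 hrs)).comp tendsto_natCast_atTop_atTop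
  filter_upwards [h.eventually_ge_atTop M, eventually_gt_atTop 0] with n hn hn0
  have hn0' : (0 : ℝ) < n := by exact_mod_cast hn0
  calc M * (n : ℝ) ^ r ≤ (n : ℝ) ^ (s - r) * (n : ℝ) ^ r := by gcongr; exact hn
    _ = _ := by rw [← Real.rpow_add hn0', sub_add_cancel]

/-- A large increment `d n` forces one of its endpoints `x n`, `x (n + 1)` to be large; the constant
drift `m` and the factor two are absorbed by the gap between the exponents `r < s`. -/
theorem frequently_rpow_le_abs_of_increments {x d : ℕ → ℝ} {m r s : ℝ} (hr : 0 ≤ r) (hrs : r < s)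
    (hx : ∀ n, x (n + 1) - x n = d n - m)
    (hd : ∃ᶠ n : ℕ in atTop, ((n : ℝ) + 1) ^ s ≤ |d n|) :
    ∃ᶠ n : ℕ in atTop, (n : ℝ) ^ r ≤ |x n| := by
  by_contra hcon
  rw [not_frequently] at hcon
  refine hd ?_
  filter_upwards [hcon, (tendsto_add_atTop_nat 1).eventually hcon,
    (tendsto_add_atTop_nat 1).eventually (eventually_const_mul_rpow_le (2 + |m|) hrs)]
    with n h1 h2 h3 h4
  push_cast at h2 h3
  rw [not_le] at h1 h2
  have h5 : (n : ℝ) ^ r ≤ ((n : ℝ) + 1) ^ r := by gcongr; linarith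
  have h6 : 1 ≤ ((n : ℝ) + 1) ^ r :=
    Real.one_le_rpow (by linarith [n.cast_nonneg (α := ℝ)]) hr
  have h7 : |d n| ≤ |x (n + 1)| + |x n| + |m| := by
    rw [show d n = x (n + 1) - x n + m by linarith [hx n]]
    exact (abs_add_le _ _).trans (add_le_add_left (abs_sub _ _) _)
  nlinarith [abs_nonneg m]

/-! ### Logarithmic growth rates -/

/-- The upper limit is determined by polynomial bounds with rational exponents on either side of
`α`; countably many exponents are what an almost sure statement can handle. -/
theorem limsup_log_abs_div_log {x : ℕ → ℝ} {α : ℝ} (hα : 0 < α)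
    (hupper : ∀ r : ℚ, α < r → ∃ M : ℝ, ∀ n : ℕ, |x n| ≤ M * (n : ℝ) ^ (r : ℝ))
    (hlower : ∀ r : ℚ, 0 < r → (r : ℝ) < α → ∃ᶠ n : ℕ in atTop, (n : ℝ) ^ (r : ℝ) ≤ |x n|) :
    limsup (fun n : ℕ => ENNReal.log (ENNReal.ofReal |x n|) / ((Real.log n : ℝ) : EReal)) atTop
      = (α : EReal) := by
  have hlog : ∀ (z : ℝ) (n : ℕ), 1 < n →
      ENNReal.log (ENNReal.ofReal ((n : ℝ) ^ z)) / ((Real.log n : ℝ) : EReal) = z := by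
    intro z n hn
    have hn' : (1 : ℝ) < n := by exact_mod_cast hn
    have h0 : 0 < Real.log n := Real.log_pos hn'
    rw [ENNReal.log_ofReal_of_pos (by positivity), Real.log_rpow (by positivity),
      ← EReal.coe_div, mul_div_cancel_right₀ _ h0.ne']
  have hlog0 : ∀ n : ℕ, (0 : EReal) ≤ ((Real.log n : ℝ) : EReal) := fun n =>
    EReal.coe_nonneg.2 (Real.log_natCast_nonneg n)
  refine le_antisymm ?_ ?_
  · refine EReal.le_of_forall_lt_iff_le.1 fun z hz => ?_
    obtain ⟨r, hr1, hr2⟩ := exists_rat_btwn (EReal.coe_lt_coe_iff.1 hz)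
    obtain ⟨M, hM⟩ := hupper r hr1
    refine limsup_le_of_le (by isBoundedDefault) ?_
    filter_upwards [eventually_const_mul_rpow_le M hr2, eventually_gt_atTop 1] with n hn hn1
    rw [← hlog z n hn1]
    refine EReal.div_le_div_right_of_nonneg (hlog0 n) (ENNReal.log_monotone ?_)
    exact ENNReal.ofReal_le_ofReal ((hM n).trans hn)
  · refine EReal.ge_of_forall_gt_iff_ge.1 fun z hz => ?_
    obtain ⟨r, hr1, hr2⟩ := exists_rat_btwn (max_lt (EReal.coe_lt_coe_iff.1 hz) hα)
    have hr0 : 0 < r := by exact_mod_cast (le_max_right z 0).trans_lt hr1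
    refine le_trans (EReal.coe_le_coe_iff.2 ((le_max_left z 0).trans hr1.le)) ?_
    refine le_limsup_of_frequently_le' ?_
    refine ((hlower r hr0 hr2).and_eventually (eventually_gt_atTop 1)).mono fun n hn => ?_
    rw [← hlog r n hn.2]
    exact EReal.div_le_div_right_of_nonneg (hlog0 n)
      (ENNReal.log_monotone (ENNReal.ofReal_le_ofReal hn.1))

theorem liminf_posLog_abs_div_log {x : ℕ → ℝ} (hx : ∃ᶠ n in atTop, |x n| < 1) :
    liminf (fun n : ℕ => ((Real.posLog |x n| / Real.log n : ℝ) : EReal)) atTop = 0 := by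
  refine le_antisymm (liminf_le_of_frequently_le' (hx.mono fun n hn => ?_))
    (le_liminf_of_le (by isBoundedDefault) (Eventually.of_forall fun n => ?_))
  · rw [(Real.posLog_eq_zero_iff _).2 (by rw [abs_abs]; exact hn.le)]
    simp
  · exact EReal.coe_nonneg.2 (div_nonneg Real.posLog_nonneg (Real.log_natCast_nonneg n))

/-! ### Near-stable walks -/

theorem memLp_of_forall_tail_le {Ω : Type*} [MeasurableSpace Ω] {P : Measure Ω}
    [IsProbabilityMeasure P] {X : Ω → ℝ} (hX : AEMeasurable X P) {γ q : ℝ} (hγ : 0 < γ)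
    (htail : ∀ ε ∈ Set.Ioo (0 : ℝ) 1, ∃ C : ℝ, ∀ t : ℝ, 1 ≤ t →
      P.real {ω | t ≤ |X ω|} ≤ C * t ^ (-((1 - ε) * γ)))
    (hq : 0 < q) (hqγ : q < γ) : MemLp X (ENNReal.ofReal q) P := by
  have hqγ' : q / γ < 1 := (div_lt_one hγ).2 hqγ
  have hqγ0 : 0 < q / γ := by positivity
  obtain ⟨C, hC⟩ := htail ((1 - q / γ) / 2) ⟨by linarith, by linarith⟩
  refine memLp_of_tail_le hX hq ?_ hC
  have : q = q / γ * γ := by field_simp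
  nlinarith

/-- The Marcinkiewicz–Zygmund bound: a centred walk whose steps have all moments of order less than
`γ` is almost surely `O(n ^ r)` for every `r > 1 / γ`. -/
theorem ae_forall_rat_exists_abs_sum_le {Ω : Type*} [MeasurableSpace Ω]
    {P : Measure Ω} [IsProbabilityMeasure P] {X : ℕ → Ω → ℝ} (hX : ∀ i, Measurable (X i))
    (hindep : iIndepFun X P) (hident : ∀ i, IdentDistrib (X i) (X 0) P P)
    (hmean : ∫ ω, X 0 ω ∂P = 0) {γ : ℝ} (hγ : γ ∈ Set.Ioo (1 : ℝ) 2)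
    (hmem : ∀ q, 0 < q → q < γ → MemLp (X 0) (ENNReal.ofReal q) P) :
    ∀ᵐ ω ∂P, ∀ r : ℚ, 1 / γ < (r : ℝ) →
      ∃ M : ℝ, ∀ n : ℕ, |∑ i ∈ Finset.range n, X i ω| ≤ M * (n : ℝ) ^ (r : ℝ) := by
  obtain ⟨hγ1, hγ2⟩ := hγ
  have hγ0 : 0 < γ := one_pos.trans hγ1
  refine ae_all_iff.2 fun r => ?_
  by_cases hr : 1 / γ < (r : ℝ)
  swap
  · exact Eventually.of_forall fun ω h => absurd h hr
  have hr0 : 0 < (r : ℝ) := lt_trans (by positivity) hr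
  -- a moment order `q < γ` with `r * q > 1` and `q > 1`
  obtain ⟨q, hq1, hq2⟩ := exists_between (max_lt ((one_div_lt hγ0 hr0).1 hr) hγ1)
  obtain ⟨hq3, hq4⟩ := max_lt_iff.1 hq1
  have hq0 : 0 < q := one_pos.trans hq4
  have hident' : ∀ i, IdentDistrib (fun ω => |X i ω| ^ q) (fun ω => |X 0 ω| ^ q) P P :=
    fun i => (hident i).comp (u := fun x => |x| ^ q) (measurable_id.abs.pow_const q)
  have hint0 : Integrable (fun ω => |X 0 ω| ^ q) P := by
    have := (hmem q hq0 hq2).integrable_norm_rpow (by simpa using hq0) ENNReal.ofReal_ne_top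
    simpa [ENNReal.toReal_ofReal hq0.le] using this
  have hX0 : Integrable (X 0) P := by
    have := hmem 1 one_pos hγ1
    rwa [ENNReal.ofReal_one, memLp_one_iff_integrable] at this
  have hconv := ae_exists_tendsto_sum_div_rpow hX hindep
    (fun i => (hident i).integrable_iff.2 hX0) (fun i => (hident i).integral_eq.trans hmean)
    (b := r) hq4.le (by linarith) ((div_lt_iff₀' hr0).1 hq3)
    (fun i => (hident' i).integrable_iff.2 hint0) (fun i => (hident' i).integral_eq.le)
  filter_upwards [hconv] with ω ⟨c, hc⟩ _
  obtain ⟨M, _, hM⟩ := exists_abs_sum_le_mul_rpow_of_tendsto hr0 hc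
  exact ⟨M, hM⟩

theorem ae_forall_rat_frequently_rpow_le_abs {Ω : Type*} [MeasurableSpace Ω]
    {P : Measure Ω} [IsProbabilityMeasure P] {X : ℕ → Ω → ℝ} (hX : ∀ i, Measurable (X i))
    (hindep : iIndepFun X P) (hident : ∀ i, IdentDistrib (X i) (X 0) P P)
    {γ : ℝ} (hγ : 0 < γ)
    (htail : ∀ ε ∈ Set.Ioo (0 : ℝ) 1, ∃ c : ℝ, 0 < c ∧ ∀ t : ℝ, 1 ≤ t →
      c * t ^ (-((1 + ε) * γ)) ≤ P.real {ω | t ≤ |X 0 ω|}) :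
    ∀ᵐ ω ∂P, ∀ r : ℚ, 0 < r → (r : ℝ) < 1 / γ →
      ∃ᶠ n : ℕ in atTop, ((n : ℝ) + 1) ^ (r : ℝ) ≤ |X n ω| := by
  refine ae_all_iff.2 fun r => ?_
  by_cases hr : 0 < r ∧ (r : ℝ) < 1 / γ
  swap
  · exact Eventually.of_forall fun ω h h' => absurd ⟨h, h'⟩ hr
  obtain ⟨hr0, hr1⟩ := hr
  have hr0' : (0 : ℝ) < r := by exact_mod_cast hr0
  have hrγ : (r : ℝ) * γ < 1 := (lt_div_iff₀ hγ).1 hr1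
  have hrγ0 : 0 < (r : ℝ) * γ := by positivity
  -- `ε = 1 - r * γ` works, since `r * (1 + ε) * γ = 1 - ε ^ 2`
  obtain ⟨c, hc0, hc⟩ := htail (1 - r * γ) ⟨by linarith, by linarith⟩
  filter_upwards [ae_frequently_rpow_le_abs hX hindep hident hr0'.le
    (by nlinarith [sq_nonneg (1 - r * γ)]) hc0 hc] with ω hω _ _ using hω

/-- Fluctuations of sums of i.i.d. near-stable random variables. The sequence is indexed from `0`,
so that `S_n = ∑ i ∈ Finset.range n, ξ i`. The upper and lower limits are taken in the extended
reals, and `ENNReal.log` is the logarithm with `log 0 = -∞`; `Real.posLog x` is `max 0 (log x)`. -/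
theorem proposition2p4 {Ω : Type*} [MeasurableSpace Ω] (P : Measure Ω) [IsProbabilityMeasure P]
    (ξ : ℕ → Ω → ℝ)
    (hindep : iIndepFun ξ P)
    (hident : ∀ i, IdentDistrib (ξ i) (ξ 0) P P)
    (γ : ℝ) (hγ : γ ∈ Set.Ioo (1 : ℝ) 2)
    (htail : ∀ ε ∈ Set.Ioo (0 : ℝ) 1, ∃ C : ℝ, 0 < C ∧ ∀ t : ℝ, 1 ≤ t →
      C⁻¹ * t ^ (-((1 + ε) * γ)) ≤ P.real {ω | t ≤ |ξ 0 ω|} ∧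
      P.real {ω | t ≤ |ξ 0 ω|} ≤ C * t ^ (-((1 - ε) * γ))) :
    Integrable (ξ 0) P ∧
    ∀ᵐ ω ∂P,
      limsup (fun n : ℕ =>
        ENNReal.log (ENNReal.ofReal |(∑ i ∈ Finset.range n, ξ i ω) - n * ∫ ω', ξ 0 ω' ∂P|) /
          ((Real.log n : ℝ) : EReal)) atTop = ((1 / γ : ℝ) : EReal) ∧
      liminf (fun n : ℕ =>
        ((Real.posLog |(∑ i ∈ Finset.range n, ξ i ω) - n * ∫ ω', ξ 0 ω' ∂P| / Real.log n : ℝ) :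
          EReal)) atTop = 0 := by
  have hγ0 : 0 < γ := one_pos.trans hγ.1
  have haem : ∀ i, AEMeasurable (ξ i) P := fun i => (hident i).aemeasurable_fst
  have hmem : ∀ q, 0 < q → q < γ → MemLp (ξ 0) (ENNReal.ofReal q) P := fun q =>
    memLp_of_forall_tail_le (haem 0) hγ0 fun ε hε => by
      obtain ⟨C, _, hC⟩ := htail ε hε
      exact ⟨C, fun t ht => (hC t ht).2⟩
  have hint : Integrable (ξ 0) P := by
    have := hmem 1 one_pos hγ.1
    rwa [ENNReal.ofReal_one, memLp_one_iff_integrable] at this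
  refine ⟨hint, ?_⟩
  set m : ℝ := ∫ ω', ξ 0 ω' ∂P with hm
  -- measurable versions of the variables, and their centred versions
  set X : ℕ → Ω → ℝ := fun i => (haem i).mk (ξ i) with hXdef
  have hXξ : ∀ i, ξ i =ᵐ[P] X i := fun i => (haem i).ae_eq_mk
  have hX : ∀ i, Measurable (X i) := fun i => (haem i).measurable_mk
  have hXindep : iIndepFun X P := hindep.congr hXξ
  have hXident : ∀ i, IdentDistrib (X i) (X 0) P P := fun i =>
    ((IdentDistrib.of_ae_eq (haem i) (hXξ i)).symm.trans (hident i)).trans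
      (IdentDistrib.of_ae_eq (haem 0) (hXξ 0))
  have hsub : Measurable fun x : ℝ => x - m := measurable_id.sub_const m
  set Z : ℕ → Ω → ℝ := fun i ω => X i ω - m with hZdef
  have hZ : ∀ i, Measurable (Z i) := fun i => (hX i).sub_const m
  have hZindep : iIndepFun Z P := hXindep.comp (fun _ x => x - m) fun _ => hsub
  have hZident : ∀ i, IdentDistrib (Z i) (Z 0) P P := fun i => (hXident i).comp hsub
  have hZmem : ∀ q, 0 < q → q < γ → MemLp (Z 0) (ENNReal.ofReal q) P := fun q hq hqγ =>
    ((memLp_congr_ae (hXξ 0)).1 (hmem q hq hqγ)).sub (memLp_const m)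
  have hXint : Integrable (X 0) P := hint.congr (hXξ 0)
  have hZint : Integrable (Z 0) P := hXint.sub (integrable_const m)
  have hZmean : ∫ ω, Z 0 ω ∂P = 0 := by
    rw [hZdef, integral_sub hXint (integrable_const m), ← integral_congr_ae (hXξ 0), ← hm]
    simp
  have hXtail : ∀ ε ∈ Set.Ioo (0 : ℝ) 1, ∃ c : ℝ, 0 < c ∧ ∀ t : ℝ, 1 ≤ t →
      c * t ^ (-((1 + ε) * γ)) ≤ P.real {ω | t ≤ |X 0 ω|} := fun ε hε => by
    obtain ⟨C, hC0, hC⟩ := htail ε hε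
    refine ⟨C⁻¹, inv_pos.2 hC0, fun t ht => (hC t ht).1.trans (le_of_eq ?_)⟩
    refine measureReal_congr ?_
    filter_upwards [hXξ 0] with ω hω
    exact congrArg (fun x => t ≤ |x|) hω
  filter_upwards [ae_all_iff.2 hXξ,
    ae_forall_rat_exists_abs_sum_le hZ hZindep hZident hZmean hγ hZmem,
    ae_forall_rat_frequently_rpow_le_abs hX hXindep hXident hγ0 hXtail,
    ae_frequently_abs_sum_lt_one hZ hZindep hZident hZint hZmean] with ω hω hup hlow hrec
  have hsum : ∀ n : ℕ, (∑ i ∈ Finset.range n, ξ i ω) - n * m = ∑ i ∈ Finset.range n, Z i ω := by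
    intro n
    simp [hZdef, hω, Finset.sum_sub_distrib]
  simp only [hsum]
  refine ⟨limsup_log_abs_div_log (by positivity) hup fun r hr0 hr1 => ?_,
    liminf_posLog_abs_div_log hrec⟩
  obtain ⟨s, hs1, hs2⟩ := exists_rat_btwn hr1
  have hrs : r < s := by exact_mod_cast hs1
  exact frequently_rpow_le_abs_of_increments (by exact_mod_cast hr0.le) hs1
    (fun n => by rw [Finset.sum_range_succ, add_sub_cancel_left]) (hlow s (hr0.trans hrs) hs2)
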